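/- For an integer $n\ge 2$ and a real $\Phi\ge 2$, let $\mathcal D_{\mathrm{all}}(n,\Phi)$ be the family of all metrics $D$ on $X=\{1,\dots,n\}$, normalized so that $\min_{x\ne y}D(x,y)=1$, whose spread $\frac{\max_{x,y}D(x,y)}{\min_{x\neq y}D(x,y)}$ is at most $\Phi$. For an integer $b>0$, a $b$-bit sketching scheme for a family $\mathcal D$ of metrics on $X$ is a pair $(\mathsf{Summ},\mathsf{Est})$, where $\mathsf{Summ}$ maps each $D\in\mathcal D$ to a bitstring of length $b$, and $\mathsf{Est}$ maps a bitstring of length $b$ and a pair of labels $x,y\in X$ to a real number. It has distortion $k$ if $$D(x,y)\le \mathsf{Est}(\mathsf{Summ}(D),x,y)\le k\cdot D(x,y)\qquad\text{for all } D\in\mathcal D,\ x,y\in X.$$ Let $b_k(\mathcal D)$ be the infimum of the integers $b>0$ for which $\mathcal D$ has a $b$-bit sketching scheme with distortion $k$ (with $b_k(\mathcal D)=\infty$ if there is none). **Theorem.** There is an absolute constant $C>0$ such that for all integers $n\ge2$, all real $0<\epsilon\le 1/2$ and all real $\Phi\ge2$, $$b_{1+\epsilon}(\mathcal D_{\mathrm{all}}(n,\Phi))\le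 C\left(n^2\log_2(1/\epsilon)+n\log_2\log_2\Phi\right);$$ in particular $b_{1+\epsilon}(\mathcal D_{\mathrm{all}}(n,\Phi))$ is finite. -/

import Mathlib

namespace MetricSketch

/-- The largest distance `max_{x,y} D(x,y)` of a metric `D` on a finite set `X`. -/
noncomputable def maxDist {X : Type*} (D : MetricSpace X) : ℝ :=
  ⨆ p : X × X, D.dist p.1 p.2

/-- The smallest distance `min_{x ≠ y} D(x,y)` between distinct points of a metric `D` on a finite
set `X` with at least two points. -/
noncomputable def minDist {X : Type*} (D : MetricSpace X) : ℝ :=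
  ⨅ p : {p : X × X // p.1 ≠ p.2}, D.dist p.1.1 p.1.2

/-- The spread of a metric: the ratio of the largest to the smallest distance. -/
noncomputable def spread {X : Type*} (D : MetricSpace X) : ℝ :=
  maxDist D / minDist D

/-- The family of all metrics on the `n` labels, normalized to have smallest distance `1`, whose
spread is at most `Φ`.  (The spread does not see the scale of a metric, and no finite number of
bits can record an arbitrary scale.) -/
def allMetrics (n : ℕ) (Φ : ℝ) : Set (MetricSpace (Fin n)) :=
  {D | minDist D = 1 ∧ spread D ≤ Φ}

/-- A deterministic `b`-bit sketching scheme for a family `𝒟` of metrics on `X`: a summary map from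
the family to bitstrings of length `b`, and an estimation map which sees the bitstring and a pair
of labels only. -/
structure SketchingScheme {X : Type*} (𝒟 : Set (MetricSpace X)) (b : ℕ) where
  /-- the summary map -/
  summ : 𝒟 → (Fin b → Bool)
  /-- the estimation map -/
  est : (Fin b → Bool) → X → X → ℝ

/-- The scheme has distortion `k`: `D(x,y) ≤ Est(Summ(D),x,y) ≤ k · D(x,y)` for every `D` in the
family and all labels `x`, `y`. -/
def SketchingScheme.HasDistortion {X : Type*} {𝒟 : Set (MetricSpace X)} {b : ℕ}
    (S : SketchingScheme 𝒟 b) (k : ℝ) : Prop :=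
  ∀ (D : 𝒟) (x y : X),
    D.1.dist x y ≤ S.est (S.summ D) x y ∧ S.est (S.summ D) x y ≤ k * D.1.dist x y

/-- `b_k(𝒟)`: the infimum of the integers `b > 0` such that `𝒟` has a `b`-bit sketching scheme with
distortion `k`; it is `⊤` if there is none. -/
noncomputable def sketchBits {X : Type*} (k : ℝ) (𝒟 : Set (MetricSpace X)) : ℕ∞ :=
  ⨅ (b : ℕ) (_ : 0 < b ∧ ∃ S : SketchingScheme 𝒟 b, S.HasDistortion k), (b : ℕ∞)

end MetricSketch

namespace MetricSketch

/-! ### Sketches from finite classifications. -/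

section Schemes

variable {X : Type*} {𝒟 : Set (MetricSpace X)}

/-! Round each distance to its level, the integer part of its logarithm to base `r = 1 + ε`; metrics
with equal levels agree up to the factor `r`. Storing every level separately would cost `log log Φ`
bits for each pair. Instead, add the points in label order and let `z` be the nearest earlier point
to `x`. For `y < x` the triangle inequality puts `max (D x z) (D z y)` within a factor 2 of `D x y`,
so its level misses that of `D x y` by at most `K = ⌈1/ε⌉` (`level_near_predictedLevel`). Only the
`n` levels of `D x z` are stored in full; each remaining pair costs a correction of `O(log (1/ε))`
bits, and the levels are recovered by induction on the labels (`level_eq_of_code_eq`). Naming the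
neighbours costs `n log n ≤ n²` bits. -/

/-- A classification of the family by at most `2 ^ b` classes, such that any two metrics of a class
agree up to the factor `k`, yields a `b`-bit sketching scheme with distortion `k`. -/
theorem exists_scheme_of_classification {γ : Type*} [Fintype γ] {b : ℕ} {k : ℝ} (c : 𝒟 → γ)
    (hcard : Fintype.card γ ≤ 2 ^ b)
    (hc : ∀ D D' : 𝒟, c D = c D' → ∀ x y, D.1.dist x y ≤ k * D'.1.dist x y) :
    ∃ S : SketchingScheme 𝒟 b, S.HasDistortion k := by
  obtain ⟨e⟩ : Nonempty (γ ↪ (Fin b → Bool)) :=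
    Function.Embedding.nonempty_of_card_le (by simpa using hcard)
  -- The supremum over a class dominates each member's distance, and the hypothesis on classes
  -- bounds it by `k` times that distance.
  refine ⟨⟨fun D => e (c D), fun s x y => sSup {t | ∃ D : 𝒟, e (c D) = s ∧ D.1.dist x y = t}⟩, ?_⟩
  intro D x y
  have ub : k * D.1.dist x y ∈
      upperBounds {t | ∃ D' : 𝒟, e (c D') = e (c D) ∧ D'.1.dist x y = t} := by
    rintro t ⟨D', h, rfl⟩
    exact hc D' D (e.injective h) x y
  exact ⟨le_csSup ⟨_, ub⟩ ⟨D, rfl, rfl⟩, csSup_le ⟨_, D, rfl, rfl⟩ ub⟩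

theorem sketchBits_le {b : ℕ} {k : ℝ} (hb : 0 < b)
    (h : ∃ S : SketchingScheme 𝒟 b, S.HasDistortion k) : sketchBits k 𝒟 ≤ b :=
  iInf₂_le (f := fun (b : ℕ) (_ : 0 < b ∧ ∃ S : SketchingScheme 𝒟 b, S.HasDistortion k) =>
    (b : ℕ∞)) b ⟨hb, h⟩

end Schemes

/-! ### Normalized metrics and levels of distances. -/

section Normalized

variable {n : ℕ} {Φ : ℝ} {D : MetricSpace (Fin n)}

theorem one_le_dist_of_mem (hD : D ∈ allMetrics n Φ) {x y : Fin n} (h : x ≠ y) :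
    1 ≤ D.dist x y := by
  rw [← hD.1]
  exact ciInf_le (f := fun p : {p : Fin n × Fin n // p.1 ≠ p.2} => D.dist p.1.1 p.1.2)
    (Set.finite_range _).bddBelow ⟨(x, y), h⟩

theorem dist_le_of_mem (hD : D ∈ allMetrics n Φ) (x y : Fin n) : D.dist x y ≤ Φ := by
  have h := hD.2
  rw [spread, hD.1, div_one] at h
  exact (le_ciSup (f := fun p : Fin n × Fin n => D.dist p.1 p.2)
    (Set.finite_range _).bddAbove (x, y)).trans h

end Normalized

section Level

variable {r d : ℝ}

/-- The integer part of the logarithm of `d` to base `r`. -/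
noncomputable def level (r d : ℝ) : ℕ := ⌊Real.logb r d⌋₊

theorem pow_level_le (hr : 1 < r) (hd : 1 ≤ d) : r ^ level r d ≤ d := by
  have h := Nat.floor_le (Real.logb_nonneg hr hd)
  rwa [Real.le_logb_iff_rpow_le hr (by linarith), Real.rpow_natCast] at h

/-- The case `d = 0` is needed: the nearest earlier neighbour of `x` may be `y` itself. -/
theorem lt_pow_level (hr : 1 < r) (hd : 0 ≤ d) : d < r ^ (level r d + 1) := by
  rcases hd.eq_or_lt with rfl | hd
  · positivity
  have h := Nat.lt_floor_add_one (Real.logb r d)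
  rw [Real.logb_lt_iff_lt_rpow hr hd] at h
  rw [← Real.rpow_natCast]
  simpa [level] using h

end Level

/-! ### The nearest-neighbour code. -/

section Code

variable {n K : ℕ} {r : ℝ}

theorem exists_nearest_earlier (D : MetricSpace (Fin n)) (x : Fin n) :
    ∃ z : Fin n, ∀ y < x, z < x ∧ D.dist x z ≤ D.dist x y := by
  by_cases h : ∃ y, y < x
  · obtain ⟨z, hz, hmin⟩ := Finset.exists_min_image (Finset.univ.filter (· < x)) (D.dist x ·)
      (by obtain ⟨y, hy⟩ := h; exact ⟨y, by simpa using hy⟩)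
    exact ⟨z, fun y hy => ⟨by simpa using hz, hmin y (by simpa using hy)⟩⟩
  · exact ⟨x, fun y hy => (h ⟨y, hy⟩).elim⟩

/-- A nearest neighbour of `x` among the labels below `x` (and a junk label if there are none). -/
noncomputable def nearestEarlier (D : MetricSpace (Fin n)) (x : Fin n) : Fin n :=
  (exists_nearest_earlier D x).choose

theorem nearestEarlier_lt (D : MetricSpace (Fin n)) {x y : Fin n} (h : y < x) :
    nearestEarlier D x < x :=
  ((exists_nearest_earlier D x).choose_spec y h).1

theorem dist_nearestEarlier_le (D : MetricSpace (Fin n)) {x y : Fin n} (h : y < x) :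
    D.dist x (nearestEarlier D x) ≤ D.dist x y :=
  ((exists_nearest_earlier D x).choose_spec y h).2

/-- The prediction of the level of `D x y`, for `y < x`, from the levels of the distances of the
nearest earlier neighbour of `x` to `x` and to `y`. -/
noncomputable def predictedLevel (r : ℝ) (D : MetricSpace (Fin n)) (x y : Fin n) : ℕ :=
  max (level r (D.dist x (nearestEarlier D x))) (level r (D.dist (nearestEarlier D x) y))

/-- Minimality of `D x z` gives `D z y ≤ D x z + D x y ≤ 2 D x y`; conversely `D x y ≤ D x z + D z
y`. Since `2 ≤ r ^ K`, a factor 2 shifts levels by at most `K`. -/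
theorem level_near_predictedLevel (hr : 1 < r) (hK : 2 ≤ r ^ K) (D : MetricSpace (Fin n))
    (hD : ∀ x y, x ≠ y → 1 ≤ D.dist x y) {x y : Fin n} (h : y < x) :
    predictedLevel r D x y ≤ level r (D.dist x y) + K ∧
      level r (D.dist x y) ≤ predictedLevel r D x y + K := by
  have hr0 : 0 < r := by linarith
  set z := nearestEarlier D x with hz
  have hzx : z < x := nearestEarlier_lt D h
  have hmin : D.dist x z ≤ D.dist x y := dist_nearestEarlier_le D h
  have hxy := hD x y h.ne'
  have hxz := hD x z hzx.ne'
  have nonneg : ∀ u v, 0 ≤ D.dist u v := fun u v => @dist_nonneg _ D.toPseudoMetricSpace u v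
  have tri1 : D.dist x y ≤ D.dist x z + D.dist z y := D.dist_triangle x z y
  have tri2 : D.dist z y ≤ D.dist x z + D.dist x y := by
    have := D.dist_triangle z x y
    rwa [D.dist_comm z x] at this
  have hlt := lt_pow_level hr (nonneg x y)
  have below : r ^ predictedLevel r D x y ≤ 2 * D.dist x y := by
    rcases max_choice (level r (D.dist x z)) (level r (D.dist z y)) with e | e <;>
      rw [predictedLevel, ← hz, e]
    · linarith [pow_level_le hr hxz]
    -- If `z = y` the level is 0 because `Real.logb r 0 = 0`, and `r ^ 0 = 1 ≤ D x y`.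
    · by_cases hzy : z = y
      · have h0 : D.dist z y = 0 := by rw [hzy]; exact D.dist_self y
        simp only [h0, level, Real.logb_zero, Nat.floor_zero, pow_zero]
        linarith
      · linarith [pow_level_le hr (hD z y hzy)]
  constructor
  · have : r ^ predictedLevel r D x y < r ^ (K + (level r (D.dist x y) + 1)) := by
      rw [pow_add r K]
      calc r ^ predictedLevel r D x y ≤ 2 * D.dist x y := below
        _ < 2 * r ^ (level r (D.dist x y) + 1) := by linarith
        _ ≤ _ := by gcongr
    have := (pow_lt_pow_iff_right₀ hr).1 this
    omega
  · have hz1 := lt_pow_level hr (nonneg x z)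
    have hz2 := lt_pow_level hr (nonneg z y)
    have h1 : r ^ (level r (D.dist x z) + 1) ≤ r ^ (predictedLevel r D x y + 1) :=
      pow_le_pow_right₀ hr.le (Nat.succ_le_succ (le_max_left _ _))
    have h2 : r ^ (level r (D.dist z y) + 1) ≤ r ^ (predictedLevel r D x y + 1) :=
      pow_le_pow_right₀ hr.le (Nat.succ_le_succ (le_max_right _ _))
    have : r ^ level r (D.dist x y) < r ^ (K + (predictedLevel r D x y + 1)) := by
      rw [pow_add r K]
      calc r ^ level r (D.dist x y) ≤ D.dist x y := pow_level_le hr hxy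
        _ < 2 * r ^ (predictedLevel r D x y + 1) := by linarith
        _ ≤ _ := by gcongr
    have := (pow_lt_pow_iff_right₀ hr).1 this
    omega

/-- The nearest earlier neighbours, the levels of the distances to them, and the errors of the
predicted levels determine the levels of all distances. -/
theorem level_eq_of_code_eq (hr : 1 < r) (hK : 2 ≤ r ^ K) (D D' : MetricSpace (Fin n))
    (hD : ∀ x y, x ≠ y → 1 ≤ D.dist x y) (hD' : ∀ x y, x ≠ y → 1 ≤ D'.dist x y)
    (hnear : ∀ x, nearestEarlier D x = nearestEarlier D' x)
    (hlevel : ∀ x, level r (D.dist x (nearestEarlier D x)) =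
      level r (D'.dist x (nearestEarlier D' x)))
    (herror : ∀ x y, y < x → level r (D.dist x y) + K - predictedLevel r D x y =
      level r (D'.dist x y) + K - predictedLevel r D' x y) (x y : Fin n) :
    level r (D.dist x y) = level r (D'.dist x y) := by
  -- Strong induction on the larger label: for `y < x`, both `z` and `y` lie below `x`, so the level
  -- of `D z y` is already known.
  have key : ∀ x : Fin n, ∀ u v, u ≤ x → v ≤ x →
      level r (D.dist u v) = level r (D'.dist u v) := by
    intro x
    induction x using WellFoundedLT.induction with
    | ind x ih =>
      have last : ∀ y, y < x → level r (D.dist x y) = level r (D'.dist x y) := by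
        intro y hy
        have hz := nearestEarlier_lt D hy
        have hp : predictedLevel r D x y = predictedLevel r D' x y := by
          have hzy := ih (max (nearestEarlier D x) y) (max_lt hz hy) (nearestEarlier D x) y
            (le_max_left _ _) (le_max_right _ _)
          rw [predictedLevel, predictedLevel, hlevel, hzy, hnear]
        -- These bounds rule out truncation in the natural subtractions of `herror`, so equal errors
        -- and equal predictions give equal levels.
        have h1 := level_near_predictedLevel hr hK D hD hy
        have h2 := level_near_predictedLevel hr hK D' hD' hy
        have h3 := herror x y hy
        omega
      intro u v hu hv
      rcases hu.eq_or_lt with rfl | hu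
      · rcases hv.eq_or_lt with rfl | hv
        · rw [D.dist_self, D'.dist_self]
        · exact last v hv
      · rcases hv.eq_or_lt with rfl | hv
        · rw [D.dist_comm, D'.dist_comm]
          exact last u hu
        · exact ih (max u v) (max_lt hu hv) u v (le_max_left _ _) (le_max_right _ _)
  exact key (max x y) x y (le_max_left _ _) (le_max_right _ _)

/-- Counting the codes of metrics up to the ratio `r`, where `K` bounds `log_r 2` and `A` bounds
`log_r Φ`. -/
theorem exists_scheme_of_card_le {A b : ℕ} {Φ : ℝ} (hr : 1 < r) (hK : 2 ≤ r ^ K)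
    (hA : Φ ≤ r ^ A) (hb : (n * (A + 1)) ^ n * (2 * K + 1) ^ (n ^ 2) ≤ 2 ^ b) :
    ∃ S : SketchingScheme (allMetrics n Φ) b, S.HasDistortion r := by
  have hone : ∀ D : allMetrics n Φ, ∀ x y, x ≠ y → 1 ≤ D.1.dist x y :=
    fun D x y h => one_le_dist_of_mem D.2 h
  have hlevel : ∀ (D : allMetrics n Φ) (x y : Fin n), level r (D.1.dist x y) < A + 1 := by
    intro D x y
    by_cases h : x = y
    · have h0 : D.1.dist x y = 0 := by rw [h]; exact D.1.dist_self y
      simp [h0, level]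
    · have := ((pow_level_le hr (hone D x y h)).trans (dist_le_of_mem D.2 x y)).trans hA
      exact Nat.lt_succ_of_le ((pow_le_pow_iff_right₀ hr).1 this)
  -- For `y < x` the shifted error lies in `[0, 2K]`, so `Fin.ofNat` does not reduce it; entries at
  -- other pairs are never read.
  let code : allMetrics n Φ → (Fin n → Fin n × Fin (A + 1)) × (Fin n × Fin n → Fin (2 * K + 1)) :=
    fun D => (fun x => (nearestEarlier D.1 x, ⟨_, hlevel D x (nearestEarlier D.1 x)⟩),
      fun p => Fin.ofNat _ (level r (D.1.dist p.1 p.2) + K - predictedLevel r D.1 p.1 p.2))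
  refine exists_scheme_of_classification code (by simpa [sq] using hb) ?_
  intro D D' h x y
  have h1 := fun x => congrFun (congrArg Prod.fst h) x
  have h2 := fun p => congrFun (congrArg Prod.snd h) p
  have e := level_eq_of_code_eq hr hK D.1 D'.1 (hone D) (hone D')
    (fun x => congrArg Prod.fst (h1 x))
    (fun x => congrArg Fin.val (congrArg Prod.snd (h1 x)))
    (fun x y hy => by
      have e := congrArg Fin.val (h2 (x, y))
      have b1 := level_near_predictedLevel hr hK D.1 (hone D) hy
      have b2 := level_near_predictedLevel hr hK D'.1 (hone D') hy
      simp only [code, Fin.val_ofNat] at e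
      rwa [Nat.mod_eq_of_lt (by omega), Nat.mod_eq_of_lt (by omega)] at e) x y
  by_cases hxy : x = y
  · rw [hxy, D.1.dist_self, D'.1.dist_self, mul_zero]
  · have := lt_pow_level hr (zero_le_one.trans (hone D x y hxy))
    rw [e, pow_succ'] at this
    have := pow_level_le hr (hone D' x y hxy)
    nlinarith

end Code

/-! ### Counting bits. -/

theorem two_le_one_add_pow_ceil {ε : ℝ} (hε : 0 < ε) : 2 ≤ (1 + ε) ^ ⌈1 / ε⌉₊ := by
  have h := one_add_mul_le_pow (by linarith : -2 ≤ ε) ⌈1 / ε⌉₊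
  have := mul_le_mul_of_nonneg_right (Nat.le_ceil (1 / ε)) hε.le
  rw [one_div_mul_cancel hε.ne'] at this
  linarith

/-- Here `t` is `1/ε` and `L` is `log₂ Φ`. As `log₂ t ≥ 1` and `n ≥ 2`, the terms `n log₂ n`, `3n`
and `n log₂ t` are absorbed into `n² log₂ t`. -/
theorem logb_card_codes_le {n : ℕ} {t L : ℝ} (hn : 2 ≤ n) (ht : 2 ≤ t) (hL : 1 ≤ L) :
    Real.logb 2 (((n * (⌈t⌉₊ * ⌈L⌉₊ + 1)) ^ n * (2 * ⌈t⌉₊ + 1) ^ (n ^ 2) : ℕ) : ℝ) ≤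
      8 * ((n : ℝ) ^ 2 * Real.logb 2 t) + n * Real.logb 2 L := by
  have hn' : (2 : ℝ) ≤ n := by exact_mod_cast hn
  have n0 : (n : ℝ) ≠ 0 := by linarith
  have ct := (Nat.ceil_lt_add_one (by linarith : 0 ≤ t)).le
  have cL := (Nat.ceil_lt_add_one (by linarith : 0 ≤ L)).le
  have two : (1 : ℝ) < 2 := one_lt_two
  have logt : 1 ≤ Real.logb 2 t := by
    rw [Real.le_logb_iff_rpow_le two (by linarith)]; simpa using ht
  have logn : Real.logb 2 n ≤ n := by
    rw [Real.logb_le_iff_le_rpow two (by linarith), Real.rpow_natCast]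
    exact_mod_cast Nat.lt_two_pow_self.le
  have logA : Real.logb 2 ((⌈t⌉₊ : ℝ) * ⌈L⌉₊ + 1) ≤ 3 + Real.logb 2 t + Real.logb 2 L := by
    have hA : (⌈t⌉₊ : ℝ) * ⌈L⌉₊ + 1 ≤ 2 ^ 3 * t * L := by
      have : (⌈t⌉₊ : ℝ) * ⌈L⌉₊ ≤ (2 * t) * (2 * L) := by gcongr <;> linarith
      nlinarith
    refine (Real.logb_le_logb_of_le two (by positivity) hA).trans_eq ?_
    rw [Real.logb_mul (by positivity) (by positivity), Real.logb_mul (by positivity) (by positivity),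
      Real.logb_pow, Real.logb_self_eq_one two]
    norm_num
  have logB : Real.logb 2 (2 * (⌈t⌉₊ : ℝ) + 1) ≤ 3 * Real.logb 2 t := by
    have hB : 2 * (⌈t⌉₊ : ℝ) + 1 ≤ t ^ 3 := by nlinarith [mul_self_nonneg (t - 2)]
    refine (Real.logb_le_logb_of_le two (by positivity) hB).trans_eq ?_
    rw [Real.logb_pow]
    norm_num
  push_cast
  rw [Real.logb_mul (by positivity) (by positivity), Real.logb_pow, Real.logb_pow,
    Real.logb_mul n0 (by positivity)]
  push_cast
  have h1 := mul_le_mul_of_nonneg_left logA (by linarith : (0 : ℝ) ≤ n)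
  have h2 := mul_le_mul_of_nonneg_left logB (by positivity : (0 : ℝ) ≤ (n : ℝ) ^ 2)
  have h3 := mul_le_mul_of_nonneg_left logn (by linarith : (0 : ℝ) ≤ n)
  have h4 := mul_le_mul_of_nonneg_left logt (by positivity : (0 : ℝ) ≤ (n : ℝ) ^ 2)
  have h5 : (n : ℝ) * Real.logb 2 t ≤ (n : ℝ) ^ 2 * Real.logb 2 t := by
    gcongr; nlinarith
  nlinarith

end MetricSketch

open MetricSketch in
theorem theorem3 :
    ∃ C : ℝ, 0 < C ∧
      ∀ (n : ℕ) (ε Φ : ℝ), 2 ≤ n → 0 < ε → ε ≤ 1 / 2 → 2 ≤ Φ →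
        ∃ b : ℕ,
          MetricSketch.sketchBits (1 + ε) (MetricSketch.allMetrics n Φ) = (b : ℕ∞) ∧
          (b : ℝ) ≤ C * ((n : ℝ) ^ 2 * Real.logb 2 (1 / ε)
            + (n : ℝ) * Real.logb 2 (Real.logb 2 Φ)) := by
  -- `9 = 8 + 1`: rounding the bit count up adds at most `1 ≤ n² log₂ (1/ε)`.
  refine ⟨9, by norm_num, fun n ε Φ hn hε hε' hΦ => ?_⟩
  have two : (1 : ℝ) < 2 := one_lt_two
  have hn' : (2 : ℝ) ≤ n := by exact_mod_cast hn
  have ht : 2 ≤ 1 / ε := by rw [le_div_iff₀ hε]; linarith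
  have hL : 1 ≤ Real.logb 2 Φ := by
    rw [Real.le_logb_iff_rpow_le two (by linarith)]; simpa using hΦ
  have logt : 1 ≤ Real.logb 2 (1 / ε) := by
    rw [Real.le_logb_iff_rpow_le two (by linarith)]; simpa using ht
  have logL : 0 ≤ (n : ℝ) * Real.logb 2 (Real.logb 2 Φ) :=
    mul_nonneg (by linarith) (Real.logb_nonneg two hL)
  have main : 1 ≤ (n : ℝ) ^ 2 * Real.logb 2 (1 / ε) := by nlinarith
  have hcard := logb_card_codes_le hn ht hL
  set N := (n * (⌈1 / ε⌉₊ * ⌈Real.logb 2 Φ⌉₊ + 1)) ^ n * (2 * ⌈1 / ε⌉₊ + 1) ^ (n ^ 2) with hN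
  have Npos : 0 < N := by positivity
  set R := 8 * ((n : ℝ) ^ 2 * Real.logb 2 (1 / ε)) + n * Real.logb 2 (Real.logb 2 Φ) with hR
  have hNb : N ≤ 2 ^ ⌈R⌉₊ := by
    have h := hcard.trans (Nat.le_ceil R)
    rw [Real.logb_le_iff_le_rpow two (by exact_mod_cast Npos), Real.rpow_natCast] at h
    exact_mod_cast h
  have hK := two_le_one_add_pow_ceil hε
  -- Each block of `⌈1/ε⌉` factors contributes at least 2, and `⌈log₂ Φ⌉` doublings reach `Φ`.
  have hA : Φ ≤ (1 + ε) ^ (⌈1 / ε⌉₊ * ⌈Real.logb 2 Φ⌉₊) := by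
    have h := Nat.le_ceil (Real.logb 2 Φ)
    rw [Real.logb_le_iff_le_rpow two (by linarith), Real.rpow_natCast] at h
    rw [pow_mul]
    exact h.trans (by gcongr)
  have hle := sketchBits_le (Nat.ceil_pos.2 (by linarith))
    (exists_scheme_of_card_le (by linarith) hK hA hNb)
  obtain ⟨b, hb⟩ := ENat.ne_top_iff_exists.1 (ne_top_of_le_ne_top (ENat.natCast_ne_top _) hle)
  refine ⟨b, hb.symm, ?_⟩
  rw [← hb, Nat.cast_le] at hle
  have : (b : ℝ) ≤ ⌈R⌉₊ := by exact_mod_cast hle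
  linarith [(Nat.ceil_lt_add_one (by linarith : 0 ≤ R)).le]
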